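/- Let $\mathcal A$ be a unital complex $C^*$-algebra. A closed two-sided ideal of $\mathcal A$ is called elementary if, as a $C^*$-algebra, it is $*$-isomorphic to the algebra $K(H')$ of the compact operators on some non-zero Hilbert space $H'$. Let $(\mathcal J_t)_{t\in T}$ be a family of elementary ideals of $\mathcal A$ with $\mathcal J_s\neq\mathcal J_t$ whenever $s\neq t$, and let $\mathcal J$ be the smallest closed two-sided ideal of $\mathcal A$ which contains all $\mathcal J_t$. For every $t\in T$ let $W_t:\mathcal A\to L(H_t)$ be an irreducible unital $*$-representation of $\mathcal A$ on a Hilbert space $H_t$ whose restriction to $\mathcal J_t$ is injective (such a representation exists and is unique up to unitary equivalence). Suppose that $(W_t)_{t\in T}$ is a spectral family for $\mathcal A$, i.e. an element $a\in\mathcal A$ is invertible if and only if all operators $W_t(a)$ are invertible and the norms $\|W_t(a)^{-1}\|$ are uniformly bounded with respect to $t\in T$. Let $H:=\bigoplus_{t\in T}H_t$ be the Hilbert space direct sum, and for $a\in\mathcal A$ let $W(a)\in L(H)$ be the operator $(x_t)_{t\in T}\mapsto (W_t(a)x_t)_{t\in T}$. Then, for every $a\in\mathcal A$, the coset $a+\mathcal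 J$ is invertible in the quotient algebra $\mathcal A/\mathcal J$ if and only if $W(a)$ is a Fredholm operator on $H$. -/

import Mathlib

open scoped ENNReal

universe u v w

section CompactOperators

variable {H : Type v} [NormedAddCommGroup H] [InnerProductSpace ℂ H] [CompleteSpace H]

/-- The adjoint of a compact operator on a Hilbert space is compact. -/
theorem isCompactOperator_star {S : H →L[ℂ] H} (hS : IsCompactOperator S) :
    IsCompactOperator (star S : H →L[ℂ] H) := by
  have hK : IsCompactOperator (S ∘L star S) := hS.comp_clm (star S)
  have key : ∀ x : H, ‖(star S) x‖ ^ 2 ≤ ‖(S ∘L star S) x‖ * ‖x‖ := by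
    intro x
    have h := ContinuousLinearMap.apply_norm_sq_eq_inner_adjoint_left (star S) x
    rw [← ContinuousLinearMap.star_eq_adjoint, star_star] at h
    rw [h]
    exact (RCLike.re_le_norm _).trans (norm_inner_le_norm _ _)
  have hT : TotallyBounded ((S ∘L star S) '' Metric.closedBall 0 1) :=
    (hK.isCompact_closure_image_closedBall (f := (S ∘L star S).toLinearMap) 1).totallyBounded.subset
      subset_closure
  refine (isCompactOperator_iff_isCompact_closure_image_closedBall
    (star S).toLinearMap one_pos).2 ?_
  refine TotallyBounded.isCompact_of_isClosed (TotallyBounded.closure ?_) isClosed_closure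
  rw [Metric.totallyBounded_iff]
  intro ε hε
  have hδ : 0 < ε ^ 2 / 2 := by positivity
  obtain ⟨t, hts, htf, hcov⟩ := Metric.finite_approx_of_totallyBounded hT (ε ^ 2 / 2) hδ
  obtain ⟨t', ht's, ht'f, rfl⟩ := Set.exists_subset_image_finite_and.1
    ⟨t, hts, htf, (rfl : t = t)⟩
  refine ⟨(star S : H →L[ℂ] H) '' t', ht'f.image _, ?_⟩
  rintro _ ⟨x, hx, rfl⟩
  obtain ⟨z, hz, hxz⟩ := Set.mem_iUnion₂.1 (hcov ⟨x, hx, rfl⟩)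
  obtain ⟨y, hy, rfl⟩ := hz
  refine Set.mem_iUnion₂.2 ⟨_, ⟨y, hy, rfl⟩, ?_⟩
  rw [Metric.mem_ball, dist_eq_norm, ← map_sub] at hxz
  change dist ((star S : H →L[ℂ] H) x) ((star S : H →L[ℂ] H) y) < ε
  rw [dist_eq_norm, ← map_sub]
  have hx1 : ‖x‖ ≤ 1 := by simpa using hx
  have hy1 : ‖y‖ ≤ 1 := by simpa using ht's hy
  have hxy : ‖x - y‖ ≤ 2 := (norm_sub_le x y).trans (by linarith)
  have h2 := key (x - y)
  have h3 : ‖(S ∘L star S) (x - y)‖ * ‖x - y‖ ≤ ‖(S ∘L star S) (x - y)‖ * 2 :=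
    mul_le_mul_of_nonneg_left hxy (norm_nonneg _)
  refine lt_of_pow_lt_pow_left₀ 2 hε.le ?_
  linarith

variable (H) in
/-- The C*-algebra `K(H)` of all compact operators on the Hilbert space `H`. -/
def compactOperators : NonUnitalStarSubalgebra ℂ (H →L[ℂ] H) where
  carrier := {S | IsCompactOperator S}
  zero_mem' := isCompactOperator_zero
  add_mem' := fun hS hR => hS.add hR
  mul_mem' := fun {_ R} hS _ => hS.comp_clm R
  smul_mem' := fun c _ hS => hS.smul c
  star_mem' := fun hS => isCompactOperator_star hS

end CompactOperators

section CStarAlgebra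

variable {A : Type u} [CStarAlgebra A]

/-- A closed two-sided ideal of `A` is *elementary* if, as a C*-algebra, it is `*`-isomorphic to
the algebra `K(H)` of the compact operators on some nonzero Hilbert space `H`; equivalently, if it
is the range of an injective `*`-homomorphism from `K(H)` to `A`. It is no restriction to
take `H` in the universe of `A`, since `H` embeds into `K(H)` (as a column of rank one operators)
and hence into `A`. -/
def IsElementaryIdeal (I : TwoSidedIdeal A) : Prop :=
  IsClosed (I : Set A) ∧
    ∃ (H : Type u) (_ : NormedAddCommGroup H) (_ : InnerProductSpace ℂ H) (_ : CompleteSpace H),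
      Nontrivial H ∧ ∃ φ : compactOperators H →⋆ₙₐ[ℂ] A,
        Function.Injective φ ∧ Set.range φ = (I : Set A)

/-- The smallest closed two-sided ideal of `A` which contains all the ideals `J t`. -/
def closedIdealSup {T : Type w} (J : T → TwoSidedIdeal A) : TwoSidedIdeal A :=
  sInf {I : TwoSidedIdeal A | IsClosed (I : Set A) ∧ ∀ t, J t ≤ I}

/-- A (unital) `*`-representation of `A` on a Hilbert space `H` is *irreducible* if `H` is nonzero
and if the only closed subspaces of `H` which are invariant under all operators `π a` are `{0}`
and `H`. -/
def IsIrreducibleRep {H : Type v} [NormedAddCommGroup H] [InnerProductSpace ℂ H] [CompleteSpace H]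
    (π : A →⋆ₐ[ℂ] (H →L[ℂ] H)) : Prop :=
  Nontrivial H ∧ ∀ K : Submodule ℂ H, IsClosed (K : Set H) →
    (∀ a : A, ∀ x ∈ K, π a x ∈ K) → K = ⊥ ∨ K = ⊤

/-- A `*`-homomorphism *lifts* an ideal if its restriction to that ideal is injective. -/
def LiftsIdeal {B : Type v} [CStarAlgebra B] (W : A →⋆ₐ[ℂ] B) (I : TwoSidedIdeal A) : Prop :=
  Set.InjOn W (I : Set A)

/-- A family of unital `*`-homomorphisms `W t` is *spectral* if an element `a` is invertible if
and only if all `W t a` are invertible and the norms of the inverses are uniformly bounded. -/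
def IsSpectralFamily {T : Type w} {B : T → Type v} [∀ t, CStarAlgebra (B t)]
    (W : ∀ t, A →⋆ₐ[ℂ] B t) : Prop :=
  ∀ a : A, IsUnit a ↔
    ∃ C : ℝ, ∀ t, ∃ b : (B t)ˣ, (b : B t) = W t a ∧ ‖((b⁻¹ : (B t)ˣ) : B t)‖ ≤ C

section Product

variable {T : Type w} {H : T → Type v} [∀ t, NormedAddCommGroup (H t)]
  [∀ t, InnerProductSpace ℂ (H t)] [∀ t, CompleteSpace (H t)]

/-- The operator `W(a)`, where `W` is the product of the representations `W t`: it acts on the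
Hilbert space direct sum of the spaces `H t` by `(x t) ↦ (W t a (x t))`. -/
noncomputable def productRep (W : ∀ t, A →⋆ₐ[ℂ] (H t →L[ℂ] H t)) (a : A) :
    lp H 2 →L[ℂ] lp H 2 :=
  lp.mapCLM 2 (fun t => W t a) (K := ‖a‖) (norm_nonneg a)
    (fun t => NonUnitalStarAlgHom.norm_apply_le (W t) a)

theorem productRep_apply (W : ∀ t, A →⋆ₐ[ℂ] (H t →L[ℂ] H t)) (a : A) (x : lp H 2) (t : T) :
    productRep W a x t = W t a (x t) :=
  rfl

end Product

end CStarAlgebra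

/-! Write W for the product representation. Distinct elementary ideals annihilate each other, and
irreducibility of `W t` with injectivity on `J t` forces `W t` to carry `J t` onto K(H t) and to
kill every other `J s` (`IsIrreducibleRep.exists_intertwining`,
`IsIrreducibleRep.map_eq_zero_of_ne`). So elements of the closed ideal act as compact operators on
the direct sum, and Atkinson's theorem gives one direction.

Conversely, if W(a) is Fredholm, its kernel has finite dimension, so all `W t a` have
finite-dimensional kernels and all but finitely many are injective. The projections P_t onto these
kernels therefore lift to one element p of the ideal. Since W(a) is bounded below off its kernel,
the operators W_t(a)* W_t(a) + P_t are coercive uniformly in t. The spectral property makes a* a + p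
invertible, so a* a is invertible modulo the ideal. The same holds for a a*, because W(a)* is also
Fredholm. -/

/-! ### Fredholm operators and compact perturbations -/

section HilbertOperators

variable {H : Type v} [NormedAddCommGroup H] [InnerProductSpace ℂ H]

/-- A compact operator is approximated in norm by its compressions to the ranges of finite rank
orthogonal projections. -/
theorem IsCompactOperator.exists_norm_sub_starProjection_comp_le {K : H →L[ℂ] H}
    (hK : IsCompactOperator K) {ε : ℝ} (hε : 0 < ε) :
    ∃ (V : Submodule ℂ H) (_ : FiniteDimensional ℂ V), ‖K - V.starProjection ∘L K‖ ≤ ε := by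
  have hT : TotallyBounded (K '' Metric.closedBall 0 1) :=
    (hK.isCompact_closure_image_closedBall (f := K.toLinearMap) 1).totallyBounded.subset
      subset_closure
  obtain ⟨t, htf, hcov⟩ := Metric.totallyBounded_iff.1 hT ε hε
  have hfin : FiniteDimensional ℂ (Submodule.span ℂ t) := FiniteDimensional.span_of_finite ℂ htf
  refine ⟨Submodule.span ℂ t, hfin, ?_⟩
  refine ContinuousLinearMap.opNorm_le_of_unit_norm hε.le fun x hx => ?_
  obtain ⟨y, hy, hxy⟩ := Set.mem_iUnion₂.1 (hcov ⟨x, by simp [hx], rfl⟩)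
  -- The projection gives the nearest point of the span of the net, so it errs by no more than the
  -- net point `y`.
  have h := Submodule.starProjection_minimal (U := Submodule.span ℂ t) (K x)
  have h2 : ‖K x - (Submodule.span ℂ t).starProjection (K x)‖ ≤ ‖K x - y‖ := by
    rw [h]
    exact ciInf_le ⟨0, by rintro _ ⟨z, rfl⟩; positivity⟩
      (⟨y, Submodule.subset_span hy⟩ : Submodule.span ℂ t)
  rw [Metric.mem_ball, dist_eq_norm] at hxy
  exact h2.trans hxy.le

theorem hasFiniteRange_starProjection_comp (V : Submodule ℂ H) [FiniteDimensional ℂ V]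
    (K : H →L[ℂ] H) : (V.starProjection ∘L K).toLinearMap.HasFiniteRange := by
  refine LinearMap.HasFiniteRange.comp_right (v := V.starProjection.toLinearMap) ?_ K.toLinearMap
  rw [LinearMap.hasFiniteRange_iff_range]
  have : V.starProjection.toLinearMap.range = V := Submodule.range_starProjection V
  rw [this]
  exact Submodule.FG.of_finite

/-- A Fredholm operator is bounded below on the orthogonal complement of its kernel. -/
theorem ContinuousLinearMap.IsFredholm.exists_le_norm_apply {S : H →L[ℂ] H} (hS : S.IsFredholm) :
    ∃ C : ℝ, 0 < C ∧ ∀ x : H, (∀ y : H, S y = 0 → inner ℂ x y = 0) → ‖x‖ ≤ C * ‖S x‖ := by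
  obtain ⟨pkg⟩ := hS.nonempty_fredholmPackage
  refine ⟨‖(pkg.equiv.symm : pkg.decCodom.X₁ →L[ℂ] pkg.decDom.X₁)‖ + 1, by positivity,
    fun x hx => ?_⟩
  set p := pkg.decDom.proj x with hp
  have hSp : S x = (pkg.equiv p : H) := by
    conv_lhs => rw [pkg.eq_equiv]
    rfl
  have hker : S (x - p) = 0 := by
    have : x - p ∈ S.ker := by
      rw [pkg.ker_eq, ← Submodule.ker_projectionOntoL pkg.decDom.isTopCompl]
      change pkg.decDom.proj (x - p) = 0
      rw [map_sub, Submodule.projectionOntoL_apply_left, ← hp, sub_self]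
    exact this
  -- The splitting need not be orthogonal, but `x` is orthogonal to the kernel element `x - p`,
  -- whence ‖x‖² = ⟪x, p⟫.
  have h1 : ‖x‖ ≤ ‖p‖ := by
    have h := hx _ hker
    rw [inner_sub_right, sub_eq_zero] at h
    have h3 : ‖x‖ * ‖x‖ ≤ ‖x‖ * ‖p‖ := by
      rw [← inner_self_eq_norm_mul_norm (𝕜 := ℂ), h]
      exact (RCLike.re_le_norm _).trans (norm_inner_le_norm _ _)
    rcases (norm_nonneg x).eq_or_lt with h0 | h0
    · rw [← h0]
      exact norm_nonneg _
    · exact le_of_mul_le_mul_left h3 h0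
  have h2 : ‖p‖ ≤ ‖(pkg.equiv.symm : pkg.decCodom.X₁ →L[ℂ] pkg.decDom.X₁)‖ * ‖S x‖ := by
    have := (pkg.equiv.symm : pkg.decCodom.X₁ →L[ℂ] pkg.decDom.X₁).le_opNorm (pkg.equiv p)
    simpa [hSp] using this
  nlinarith [norm_nonneg (S x)]

variable [CompleteSpace H]

-- Splitting S - 1 into a finite rank part F and a part of norm at most 1/2 makes S - F invertible
-- by the Neumann series. Its inverse is a quasi-inverse of S.
open scoped LinearMap.FiniteRangeSetoid in
theorem exists_isQuasiInverse_of_isCompactOperator_sub_one {S : H →L[ℂ] H}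
    (hS : IsCompactOperator (S - 1 : H →L[ℂ] H)) :
    ∃ G : H →L[ℂ] H, G.IsQuasiInverse (S : H →ₗ[ℂ] H) := by
  obtain ⟨V, _, hV⟩ := hS.exists_norm_sub_starProjection_comp_le (K := S - 1) (ε := 1 / 2) (by simp)
  set F := V.starProjection ∘L (S - 1) with hF
  have hFr : F.toLinearMap.HasFiniteRange := hasFiniteRange_starProjection_comp V _
  obtain ⟨N, hN⟩ : IsUnit (S - F) := by
    have : ‖F - (S - 1)‖ < 1 := by
      rw [norm_sub_rev]
      linarith
    convert isUnit_one_sub_of_norm_lt_one this using 1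
    abel
  refine ⟨(N⁻¹ : (H →L[ℂ] H)ˣ), ?_, ?_⟩
  · refine LinearMap.FiniteRangeSetoid.equiv_iff_hasFiniteRange.2 ?_
    have : (((N⁻¹ : (H →L[ℂ] H)ˣ) : H →L[ℂ] H) * S - 1) = ((N⁻¹ : (H →L[ℂ] H)ˣ) * F) := by
      rw [sub_eq_iff_eq_add, ← N.inv_mul, ← mul_add, hN]
      simp
    change (((N⁻¹ : (H →L[ℂ] H)ˣ) : H →L[ℂ] H) * S - 1).toLinearMap.HasFiniteRange
    rw [this]
    exact hFr.comp_left ((N⁻¹ : (H →L[ℂ] H)ˣ) : H →L[ℂ] H).toLinearMap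
  · refine LinearMap.FiniteRangeSetoid.equiv_iff_hasFiniteRange.2 ?_
    have : (S * ((N⁻¹ : (H →L[ℂ] H)ˣ) : H →L[ℂ] H) - 1) = F * (N⁻¹ : (H →L[ℂ] H)ˣ) := by
      rw [sub_eq_iff_eq_add, ← N.mul_inv, ← add_mul, hN]
      simp
    change (S * ((N⁻¹ : (H →L[ℂ] H)ˣ) : H →L[ℂ] H) - 1).toLinearMap.HasFiniteRange
    rw [this]
    exact hFr.comp_right ((N⁻¹ : (H →L[ℂ] H)ˣ) : H →L[ℂ] H).toLinearMap

open scoped LinearMap.FiniteRangeSetoid in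
/-- **Atkinson's theorem**: an operator which is invertible modulo the compact operators is
Fredholm. -/
theorem ContinuousLinearMap.IsFredholm.of_isCompactOperator_mul_sub_one {S R : H →L[ℂ] H}
    (h₁ : IsCompactOperator (S * R - 1 : H →L[ℂ] H))
    (h₂ : IsCompactOperator (R * S - 1 : H →L[ℂ] H)) : S.IsFredholm := by
  obtain ⟨G₁, -, hG₁⟩ := exists_isQuasiInverse_of_isCompactOperator_sub_one h₁
  obtain ⟨G₂, hG₂, -⟩ := exists_isQuasiInverse_of_isCompactOperator_sub_one h₂
  have e₁ : S.toLinearMap ∘ₗ (R.toLinearMap ∘ₗ G₁.toLinearMap) ≈ LinearMap.id := hG₁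
  have e₂ : (G₂.toLinearMap ∘ₗ R.toLinearMap) ∘ₗ S.toLinearMap ≈ LinearMap.id := hG₂
  refine .of_isQuasiInverse (v := R ∘L G₁) ⟨?_, e₁⟩
  -- A left and a right inverse modulo finite rank agree modulo finite rank.
  have h : R.toLinearMap ∘ₗ G₁.toLinearMap ≈ G₂.toLinearMap ∘ₗ R.toLinearMap :=
    calc R.toLinearMap ∘ₗ G₁.toLinearMap
      _ ≈ ((G₂.toLinearMap ∘ₗ R.toLinearMap) ∘ₗ S.toLinearMap) ∘ₗ
            (R.toLinearMap ∘ₗ G₁.toLinearMap) :=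
          Setoid.symm (LinearMap.FiniteRangeSetoid.equiv_comp_right
            (u := R.toLinearMap ∘ₗ G₁.toLinearMap) e₂)
      _ ≈ G₂.toLinearMap ∘ₗ R.toLinearMap :=
          LinearMap.FiniteRangeSetoid.equiv_comp_left
            (u' := G₂.toLinearMap ∘ₗ R.toLinearMap) e₁
  exact Setoid.trans (LinearMap.FiniteRangeSetoid.equiv_comp_right (u := S.toLinearMap) h) e₂

theorem hasFiniteRange_star {F : H →L[ℂ] H} (hF : F.toLinearMap.HasFiniteRange) :
    (star F : H →L[ℂ] H).toLinearMap.HasFiniteRange := by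
  rw [LinearMap.hasFiniteRange_iff_range] at hF ⊢
  have : FiniteDimensional ℂ F.toLinearMap.range := Module.Finite.of_fg hF
  refine Submodule.FG.of_le (hF.map (star F : H →L[ℂ] H).toLinearMap) ?_
  rintro _ ⟨y, rfl⟩
  -- With P the projection onto the range of F, PF = F gives F* = F* P.
  refine ⟨F.toLinearMap.range.starProjection y, Submodule.starProjection_apply_mem _ _, ?_⟩
  refine ext_inner_right ℂ fun x => ?_
  change inner ℂ (star F (F.toLinearMap.range.starProjection y)) x = inner ℂ (star F y) x
  rw [ContinuousLinearMap.star_eq_adjoint, ContinuousLinearMap.adjoint_inner_left,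
    ContinuousLinearMap.adjoint_inner_left, Submodule.inner_starProjection_left_eq_right]
  exact congrArg (inner ℂ y)
    (Submodule.starProjection_eq_self_iff.2 (LinearMap.mem_range_self F.toLinearMap x))

open scoped LinearMap.FiniteRangeSetoid in
theorem ContinuousLinearMap.IsFredholm.star {S : H →L[ℂ] H} (hS : S.IsFredholm) :
    (star S : H →L[ℂ] H).IsFredholm := by
  obtain ⟨R, hR₁, hR₂⟩ := hS.exists_isQuasiInverse
  have h₁ : (R * S - 1 : H →L[ℂ] H).toLinearMap.HasFiniteRange :=
    LinearMap.FiniteRangeSetoid.equiv_iff_hasFiniteRange.1 hR₁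
  have h₂ : (S * R - 1 : H →L[ℂ] H).toLinearMap.HasFiniteRange :=
    LinearMap.FiniteRangeSetoid.equiv_iff_hasFiniteRange.1 hR₂
  have h₁' := hasFiniteRange_star h₁
  have h₂' := hasFiniteRange_star h₂
  rw [star_sub, star_mul, star_one] at h₁' h₂'
  exact .of_isQuasiInverse (v := Star.star R)
    ⟨LinearMap.FiniteRangeSetoid.equiv_iff_hasFiniteRange.2 h₂',
      LinearMap.FiniteRangeSetoid.equiv_iff_hasFiniteRange.2 h₁'⟩

end HilbertOperators

/-! ### Rank one operators and simplicity of K(H) -/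

section CompactOperators

variable {H : Type v} [NormedAddCommGroup H] [InnerProductSpace ℂ H]

theorem isCompactOperator_starProjection (V : Submodule ℂ H) [FiniteDimensional ℂ V] :
    IsCompactOperator (V.starProjection : H →L[ℂ] H) :=
  (isCompactOperator_of_locallyCompactSpace_dom V.orthogonalProjectionOnto).clm_comp V.subtypeL

variable [CompleteSpace H]

instance isClosed_compactOperators :
    IsClosed (compactOperators H : Set (H →L[ℂ] H)) :=
  isClosed_setOfPred_isCompactOperator

/-- The rank one operator `z ↦ ⟪y, z⟫ x` as an element of `K(H)`. -/
noncomputable def compactRankOne (x y : H) : compactOperators H :=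
  ⟨InnerProductSpace.rankOne ℂ x y,
    (isCompactOperator_of_locallyCompactSpace_dom (innerSL ℂ y)).clm_comp
      (ContinuousLinearMap.toSpanSingleton ℂ x)⟩

theorem compactRankOne_apply (x y z : H) : (compactRankOne x y).1 z = inner ℂ y z • x :=
  rfl

theorem mul_compactRankOne (k : compactOperators H) (x y : H) :
    k * compactRankOne x y = compactRankOne (k.1 x) y :=
  Subtype.ext (InnerProductSpace.comp_rankOne x y k.1)

theorem compactRankOne_mul_compactRankOne (x y z w : H) :
    compactRankOne x y * compactRankOne z w = inner ℂ y z • compactRankOne x w :=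
  Subtype.ext (InnerProductSpace.rankOne_comp_rankOne x y z w)

theorem star_compactRankOne (x y : H) : star (compactRankOne x y) = compactRankOne y x :=
  Subtype.ext (InnerProductSpace.adjoint_rankOne x y)

theorem compactRankOne_add (x x' y : H) :
    compactRankOne (x + x') y = compactRankOne x y + compactRankOne x' y :=
  Subtype.ext (by simp [compactRankOne])

theorem compactRankOne_smul (c : ℂ) (x y : H) :
    compactRankOne (c • x) y = c • compactRankOne x y :=
  Subtype.ext (by simp [compactRankOne])

theorem compactRankOne_ne_zero {x y : H} (hx : x ≠ 0) (hy : y ≠ 0) : compactRankOne x y ≠ 0 := by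
  intro h
  have h1 : (compactRankOne x y).1 y = 0 := by
    rw [h]
    rfl
  rw [compactRankOne_apply] at h1
  simp [hx, hy] at h1

/-- `K(H)` is topologically simple. -/
theorem compactOperators_subset_of_ideal {S : Set (compactOperators H)} (hS : IsClosed S)
    (hzero : 0 ∈ S)
    (hadd : ∀ k ∈ S, ∀ l ∈ S, k + l ∈ S) (hleft : ∀ k, ∀ l ∈ S, k * l ∈ S)
    (hright : ∀ k ∈ S, ∀ l, k * l ∈ S) {k : compactOperators H} (hk : k ∈ S) (hk0 : k ≠ 0)
    (l : compactOperators H) : l ∈ S := by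
  obtain ⟨x, hx⟩ : ∃ x, k.1 x ≠ 0 := by
    by_contra! h
    exact hk0 (Subtype.ext (ContinuousLinearMap.ext h))
  have hc : inner ℂ (k.1 x) (k.1 x) ≠ 0 := by simpa using hx
  have hone : ∀ y z : H, compactRankOne y z ∈ S := by
    intro y z
    -- Sandwiching `k` between rank one operators yields any rank one operator; the scalar
    -- normalises the factor ⟪k x, k x⟫.
    have h := hleft (compactRankOne ((inner ℂ (k.1 x) (k.1 x))⁻¹ • y) (k.1 x)) _
      (hright k hk (compactRankOne x z))
    rwa [mul_compactRankOne, compactRankOne_mul_compactRankOne, ← compactRankOne_smul, smul_smul,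
      mul_inv_cancel₀ hc, one_smul] at h
  refine hS.closure_subset (Metric.mem_closure_iff.2 fun ε hε => ?_)
  obtain ⟨V, _, hV⟩ := IsCompactOperator.exists_norm_sub_starProjection_comp_le (K := l.1) l.2
    (half_pos hε)
  let b := stdOrthonormalBasis ℂ V
  let p : compactOperators H := ∑ i, compactRankOne (b i : H) (b i : H)
  have hp : p.1 = V.starProjection := by
    rw [b.starProjection_eq_sum_rankOne]
    exact AddSubmonoidClass.coe_finsetSum _ _
  have hpS : p ∈ S :=
    Finset.sum_induction _ (· ∈ S) (fun k l hk hl => hadd k hk l hl) hzero fun i _ => hone _ _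
  refine ⟨p * l, hright p hpS l, ?_⟩
  rw [dist_eq_norm]
  have : ‖l - p * l‖ = ‖l.1 - V.starProjection ∘L l.1‖ := by
    rw [← hp]
    rfl
  linarith

end CompactOperators

/-! ### Elementary ideals and their irreducible representations -/

section ElementaryIdeals

variable {A : Type u} [CStarAlgebra A]

/-- An elementary ideal contains no proper nonzero closed ideals of the algebra. -/
theorem IsElementaryIdeal.le_of_mem {I L : TwoSidedIdeal A} (hI : IsElementaryIdeal I)
    (hL : IsClosed (L : Set A)) {a : A} (haI : a ∈ I) (haL : a ∈ L) (ha : a ≠ 0) : I ≤ L := by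
  obtain ⟨-, H, _, _, _, _, φ, -, hφI⟩ := hI
  have hmem : ∀ {b : A}, b ∈ I → ∃ k, φ k = b := fun {b} hb => by
    have : b ∈ Set.range φ := hφI ▸ hb
    exact this
  obtain ⟨k, rfl⟩ := hmem haI
  have hcont : Continuous φ :=
    AddMonoidHomClass.continuous_of_bound φ 1 fun x => by
      simpa using NonUnitalStarAlgHom.norm_apply_le φ x
  intro b hb
  obtain ⟨l, rfl⟩ := hmem hb
  refine compactOperators_subset_of_ideal (S := φ ⁻¹' (L : Set A)) (hL.preimage hcont)
    ?_ ?_ ?_ ?_ (k := k) haL (fun h => ha (by rw [h, map_zero])) l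
  · simp [L.zero_mem]
  · intro x hx y hy
    simpa using L.add_mem hx hy
  · intro x y hy
    simpa using L.mul_mem_left _ _ hy
  · intro x hx y
    simpa using L.mul_mem_right _ _ hx

/-- Two different elementary ideals annihilate each other. -/
theorem IsElementaryIdeal.mul_eq_zero {I L : TwoSidedIdeal A} (hI : IsElementaryIdeal I)
    (hL : IsElementaryIdeal L) (h : I ≠ L) {a b : A} (ha : a ∈ I) (hb : b ∈ L) : a * b = 0 := by
  by_contra hab
  -- The product lies in both ideals, so if it were nonzero, simplicity would make each contain the
  -- other.
  have h₁ := I.mul_mem_right a b ha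
  have h₂ := L.mul_mem_left a b hb
  exact h (le_antisymm (hI.le_of_mem hL.1 h₁ h₂ hab) (hL.le_of_mem hI.1 h₂ h₁ hab))

variable {H : Type v} [NormedAddCommGroup H] [InnerProductSpace ℂ H] [CompleteSpace H]

/-- An irreducible representation which is injective on an ideal isomorphic to `K(E)` restricts to
a representation of `K(E)` which is unitarily equivalent to the identity representation. -/
theorem IsIrreducibleRep.exists_intertwining {W : A →⋆ₐ[ℂ] (H →L[ℂ] H)} (hW : IsIrreducibleRep W)
    {I : TwoSidedIdeal A} (hlift : LiftsIdeal W I) {E : Type w} [NormedAddCommGroup E]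
    [InnerProductSpace ℂ E] [CompleteSpace E] [Nontrivial E] {φ : compactOperators E →⋆ₙₐ[ℂ] A}
    (hφ : Function.Injective φ) (hφI : Set.range φ = (I : Set A)) :
    ∃ U : E ≃ₗᵢ[ℂ] H, ∀ k x, W (φ k) (U x) = U (k.1 x) := by
  obtain ⟨e, he⟩ := exists_norm_eq E zero_le_one
  have he0 : e ≠ 0 := by
    rintro rfl
    simp at he
  have hee : inner ℂ e e = 1 := by
    rw [inner_self_eq_norm_sq_to_K, he]
    simp
  have hmem : ∀ k, φ k ∈ I := fun k => by
    have : φ k ∈ (I : Set A) := hφI ▸ Set.mem_range_self k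
    exact this
  obtain ⟨w, hw⟩ : ∃ w, W (φ (compactRankOne e e)) w ≠ 0 := by
    by_contra! h
    refine compactRankOne_ne_zero he0 he0 (hφ (hlift (hmem _) (hmem _) ?_))
    rw [map_zero, map_zero]
    exact ContinuousLinearMap.ext h
  set c : ℂ := (‖W (φ (compactRankOne e e)) w‖ : ℂ)⁻¹ with hc
  -- A unit vector fixed by the image of the rank one projection onto `e`; U will send `e` to `v`.
  set v := c • W (φ (compactRankOne e e)) w with hv
  have hvnorm : ‖v‖ = 1 := by
    rw [hv, norm_smul, hc, norm_inv, Complex.norm_real, norm_norm,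
      inv_mul_cancel₀ (norm_ne_zero_iff.2 hw)]
  have hmul : ∀ k l : compactOperators E, ∀ y, W (φ (k * l)) y = W (φ k) (W (φ l) y) := by
    intro k l y
    rw [map_mul, map_mul]
    rfl
  have hsmul : ∀ (z : ℂ) (k : compactOperators E) (y : H), W (φ (z • k)) y = z • W (φ k) y := by
    intro z k y
    rw [map_smul φ, map_smul W]
    rfl
  have hqv : W (φ (compactRankOne e e)) v = v := by
    rw [hv, map_smul, ← hmul, compactRankOne_mul_compactRankOne, hee, one_smul]
  let U₀ : E →ₗ[ℂ] H :=
    { toFun := fun x => W (φ (compactRankOne x e)) v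
      map_add' := fun x y => by
        rw [compactRankOne_add, map_add, map_add]
        rfl
      map_smul' := fun z x => by
        rw [compactRankOne_smul, hsmul]
        rfl }
  have hU₀ : ∀ x, U₀ x = W (φ (compactRankOne x e)) v := fun x => rfl
  have hnorm : ∀ x, ‖U₀ x‖ = ‖x‖ := by
    intro x
    -- With x ⊗ e for `compactRankOne x e`, (x ⊗ e)* (x ⊗ e) = ⟪x, x⟫ (e ⊗ e), and e ⊗ e acts on `v`
    -- as the identity.
    have h : inner ℂ (U₀ x) (U₀ x) = inner ℂ x x := by
      rw [hU₀, ← ContinuousLinearMap.adjoint_inner_right, ← ContinuousLinearMap.star_eq_adjoint,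
        ← map_star, ← map_star, star_compactRankOne, ← hmul, compactRankOne_mul_compactRankOne,
        hsmul, hqv, inner_smul_right,
        inner_self_eq_norm_sq_to_K (𝕜 := ℂ) v, hvnorm]
      simp
    rw [inner_self_eq_norm_sq_to_K, inner_self_eq_norm_sq_to_K] at h
    exact (sq_eq_sq₀ (norm_nonneg _) (norm_nonneg _)).1 (by exact_mod_cast h)
  let U₁ : E →ₗᵢ[ℂ] H := ⟨U₀, hnorm⟩
  have hinter : ∀ k x, W (φ k) (U₀ x) = U₀ (k.1 x) := by
    intro k x
    rw [hU₀, hU₀, ← hmul, mul_compactRankOne]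
  have hrange : U₀.range = ⊤ := by
    refine (hW.2 U₀.range ?_ ?_).resolve_left ?_
    · exact U₁.isometry.isClosedEmbedding.isClosed_range
    · rintro a _ ⟨x, rfl⟩
      -- The ideal property makes the range invariant under all of `A`, not only under the image of
      -- φ, so irreducibility applies.
      have ha : a * φ (compactRankOne x e) ∈ (I : Set A) := I.mul_mem_left _ _ (hmem _)
      rw [← hφI] at ha
      obtain ⟨k, hk⟩ := ha
      refine ⟨k.1 e, ?_⟩
      rw [← hinter, hk, map_mul, hU₀, hqv, hU₀]
      rfl
    · intro h
      rw [LinearMap.range_eq_bot] at h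
      have := hnorm e
      rw [h, he] at this
      simp at this
  exact ⟨LinearIsometryEquiv.ofSurjective U₁ (LinearMap.range_eq_top.1 hrange), hinter⟩

/-- An irreducible representation which is injective on an elementary ideal maps this ideal
into the compact operators. -/
theorem IsIrreducibleRep.isCompactOperator_of_mem {W : A →⋆ₐ[ℂ] (H →L[ℂ] H)}
    (hW : IsIrreducibleRep W) {I : TwoSidedIdeal A} (hI : IsElementaryIdeal I)
    (hlift : LiftsIdeal W I) {a : A} (ha : a ∈ I) : IsCompactOperator (W a) := by
  obtain ⟨-, E, _, _, _, _, φ, hφ, hφI⟩ := hI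
  obtain ⟨U, hU⟩ := hW.exists_intertwining hlift hφ hφI
  have ha' : a ∈ (I : Set A) := ha
  rw [← hφI] at ha'
  obtain ⟨k, rfl⟩ := ha'
  have hk : IsCompactOperator k.1 := k.2
  have h := (hk.comp_clm (U.symm : H ≃L[ℂ] E).toContinuousLinearMap).clm_comp
    (U : E ≃L[ℂ] H).toContinuousLinearMap
  have heq : (W (φ k) : H → H) = fun x => U (k.1 (U.symm x)) := by
    ext x
    rw [← hU, U.apply_symm_apply]
  rw [heq]
  exact h

/-- An irreducible representation which is injective on an elementary ideal maps this ideal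
onto the compact operators. -/
theorem IsIrreducibleRep.exists_mem_map_eq {W : A →⋆ₐ[ℂ] (H →L[ℂ] H)}
    (hW : IsIrreducibleRep W) {I : TwoSidedIdeal A} (hI : IsElementaryIdeal I)
    (hlift : LiftsIdeal W I) {S : H →L[ℂ] H} (hS : IsCompactOperator S) : ∃ a ∈ I, W a = S := by
  obtain ⟨-, E, _, _, _, _, φ, hφ, hφI⟩ := hI
  obtain ⟨U, hU⟩ := hW.exists_intertwining hlift hφ hφI
  let k : compactOperators E :=
    ⟨(U.symm : H ≃L[ℂ] E).toContinuousLinearMap ∘L S ∘L (U : E ≃L[ℂ] H).toContinuousLinearMap,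
      (hS.comp_clm (U : E ≃L[ℂ] H).toContinuousLinearMap).clm_comp
        (U.symm : H ≃L[ℂ] E).toContinuousLinearMap⟩
  have hk : φ k ∈ (I : Set A) := hφI ▸ Set.mem_range_self k
  refine ⟨φ k, hk, ContinuousLinearMap.ext fun x => ?_⟩
  obtain ⟨y, rfl⟩ := U.surjective x
  rw [hU]
  exact U.apply_symm_apply _

/-- An irreducible representation which is injective on an elementary ideal vanishes on all other
elementary ideals. -/
theorem IsIrreducibleRep.map_eq_zero_of_ne {W : A →⋆ₐ[ℂ] (H →L[ℂ] H)}
    (hW : IsIrreducibleRep W) {I L : TwoSidedIdeal A} (hI : IsElementaryIdeal I)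
    (hL : IsElementaryIdeal L) (hlift : LiftsIdeal W I) (h : L ≠ I) {a : A} (ha : a ∈ L) :
    W a = 0 := by
  ext x
  -- Any `x` is fixed by `W b` for some `b` in `I`, and `a * b = 0`.
  obtain ⟨b, hb, hbx⟩ := hW.exists_mem_map_eq hI hlift (isCompactOperator_starProjection (ℂ ∙ x))
  have hx : W b x = x := by
    rw [hbx, Submodule.starProjection_eq_self_iff.2 (Submodule.mem_span_singleton_self x)]
  calc W a x = W a (W b x) := by rw [hx]
    _ = W (a * b) x := by
      rw [map_mul]
      rfl
    _ = 0 := by rw [hL.mul_eq_zero hI h ha hb, map_zero]; rfl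

end ElementaryIdeals

/-! ### Coercivity with explicit constants -/

section Coercive

variable {H : Type v} [NormedAddCommGroup H] [InnerProductSpace ℂ H] [CompleteSpace H]

/-- Lax–Milgram. The inverse is bounded by the coercivity constant alone, as the uniform bound of a
spectral family demands. -/
theorem exists_unit_norm_inv_le_of_coercive {S : H →L[ℂ] H} {M : ℝ} (hM : 0 < M)
    (h : ∀ x, ‖x‖ ^ 2 ≤ M * ‖inner ℂ (S x) x‖) :
    ∃ b : (H →L[ℂ] H)ˣ, (b : H →L[ℂ] H) = S ∧ ‖((b⁻¹ : (H →L[ℂ] H)ˣ) : H →L[ℂ] H)‖ ≤ M := by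
  obtain ⟨b, rfl⟩ : IsUnit S := by
    refine ContinuousLinearMap.isUnit_of_forall_le_norm_inner_map S
      (c := ⟨M⁻¹, (inv_pos.2 hM).le⟩) (inv_pos.2 hM) fun x => ?_
    change ‖x‖ ^ 2 * M⁻¹ ≤ _
    rw [← div_eq_mul_inv, div_le_iff₀' hM]
    exact h x
  refine ⟨b, rfl, ContinuousLinearMap.opNorm_le_bound _ hM.le fun y => ?_⟩
  set x := ((b⁻¹ : (H →L[ℂ] H)ˣ) : H →L[ℂ] H) y with hx
  have hy : (b : H →L[ℂ] H) x = y := by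
    rw [hx, ← mul_apply_eq_comp, b.mul_inv, one_apply_eq_self]
  have h1 := h x
  rw [hy] at h1
  have h2 : ‖x‖ * ‖x‖ ≤ M * ‖y‖ * ‖x‖ := by
    rw [← sq, mul_assoc]
    exact h1.trans (mul_le_mul_of_nonneg_left (norm_inner_le_norm _ _) hM.le)
  rcases (norm_nonneg x).eq_or_lt with h0 | h0
  · rw [← h0]
    positivity
  · exact le_of_mul_le_mul_right h2 h0

/-- If `S` is bounded below on the orthogonal complement of its kernel, then
`S* S + P` is coercive, where `P` is the orthogonal projection onto the kernel. -/
theorem coercive_star_mul_self_add_starProjection_ker {S : H →L[ℂ] H} {C : ℝ}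
    [S.ker.HasOrthogonalProjection]
    (hS : ∀ x : H, (∀ y : H, S y = 0 → inner ℂ x y = 0) → ‖x‖ ≤ C * ‖S x‖) (x : H) :
    ‖x‖ ^ 2 ≤ (C ^ 2 + 1) * ‖inner ℂ ((star S * S + S.ker.starProjection) x) x‖ := by
  have hP : S (S.ker.starProjection x) = 0 := S.ker.starProjection_apply_mem x
  have h1 : ‖x - S.ker.starProjection x‖ ≤ C * ‖S x‖ := by
    have := hS (x - S.ker.starProjection x) fun y hy =>
      S.ker.starProjection_inner_eq_zero x y hy
    rwa [map_sub, hP, sub_zero] at this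
  have h2 : ‖x‖ ^ 2 = ‖x - S.ker.starProjection x‖ ^ 2 + ‖S.ker.starProjection x‖ ^ 2 := by
    rw [S.ker.norm_sq_eq_add_norm_sq_starProjection x, Submodule.starProjection_orthogonal_val]
    ring
  have h3 : ‖S x‖ ^ 2 + ‖S.ker.starProjection x‖ ^ 2 ≤
      ‖inner ℂ ((star S * S + S.ker.starProjection) x) x‖ := by
    refine le_trans (le_of_eq ?_) (RCLike.re_le_norm _)
    rw [add_apply, inner_add_left, mul_apply_eq_comp,
      ContinuousLinearMap.star_eq_adjoint, ContinuousLinearMap.adjoint_inner_left, map_add,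
      Submodule.re_inner_starProjection_eq_normSq, inner_self_eq_norm_sq]
    rfl
  have h4 : ‖x - S.ker.starProjection x‖ ^ 2 ≤ C ^ 2 * ‖S x‖ ^ 2 := by
    rw [← mul_pow]
    exact pow_le_pow_left₀ (norm_nonneg _) h1 2
  calc ‖x‖ ^ 2 ≤ (C ^ 2 + 1) * (‖S x‖ ^ 2 + ‖S.ker.starProjection x‖ ^ 2) := by
        nlinarith [sq_nonneg (C * ‖S.ker.starProjection x‖), sq_nonneg ‖S x‖]
    _ ≤ _ := mul_le_mul_of_nonneg_left h3 (by positivity)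

end Coercive

/-! ### The product representation and lifting of kernel projections -/

section Product

variable {A : Type u} [CStarAlgebra A] {T : Type w} {H : T → Type v}
  [∀ t, NormedAddCommGroup (H t)] [∀ t, InnerProductSpace ℂ (H t)] [∀ t, CompleteSpace (H t)]
  (W : ∀ t, A →⋆ₐ[ℂ] (H t →L[ℂ] H t))

/-- The product of the representations `W t` as a ring homomorphism. -/
noncomputable def productRepHom : A →+* (lp H 2 →L[ℂ] lp H 2) where
  toFun := productRep W
  map_one' := by
    ext x t
    rw [productRep_apply, map_one]
    rfl
  map_mul' a b := by
    ext x t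
    rw [productRep_apply, map_mul]
    rfl
  map_zero' := by
    ext x t
    rw [productRep_apply, map_zero]
    rfl
  map_add' a b := by
    ext x t
    rw [productRep_apply, map_add]
    rfl

theorem productRepHom_apply (a : A) : productRepHom W a = productRep W a :=
  rfl

theorem productRep_star (a : A) : productRep W (star a) = star (productRep W a) := by
  rw [ContinuousLinearMap.star_eq_adjoint, ContinuousLinearMap.eq_adjoint_iff]
  intro x y
  rw [lp.inner_eq_tsum, lp.inner_eq_tsum]
  refine tsum_congr fun t => ?_
  rw [productRep_apply, productRep_apply, map_star, ContinuousLinearMap.star_eq_adjoint,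
    ContinuousLinearMap.adjoint_inner_left]

theorem productRep_single [DecidableEq T] (a : A) (t : T) (x : H t) :
    productRep W a (lp.single 2 t x) = lp.single 2 t (W t a x) := by
  ext s
  rw [productRep_apply, lp.single_apply, lp.single_apply]
  by_cases h : s = t
  · subst h
    simp
  · simp [h]

/-- The two-sided ideal of all elements which are mapped to compact operators by the product of the
representations `W t`. -/
noncomputable def compactIdeal : TwoSidedIdeal A :=
  .mk' {a | IsCompactOperator (productRepHom W a)}
    (by simpa using isCompactOperator_zero)
    (fun {a b} ha hb => by
      simp only [Set.mem_ofPred_eq, map_add] at *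
      exact ha.add hb)
    (fun {a} ha => by
      simp only [Set.mem_ofPred_eq, map_neg] at *
      exact ha.neg)
    (fun {a b} hb => by
      simp only [Set.mem_ofPred_eq, map_mul] at *
      exact hb.clm_comp (productRepHom W a))
    (fun {a b} ha => by
      simp only [Set.mem_ofPred_eq, map_mul] at *
      exact ha.comp_clm (productRepHom W b))

theorem mem_compactIdeal {a : A} : a ∈ compactIdeal W ↔ IsCompactOperator (productRep W a) :=
  TwoSidedIdeal.mem_mk' ..

theorem isClosed_compactIdeal : IsClosed (compactIdeal W : Set A) := by
  have hcont : Continuous (productRepHom W) :=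
    AddMonoidHomClass.continuous_of_bound (productRepHom W) 1 fun a => by
      rw [one_mul]
      exact lp.norm_mapCLM_le 2 (fun t => W t a) (norm_nonneg a)
        fun t => NonUnitalStarAlgHom.norm_apply_le (W t) a
  have hset : (compactIdeal W : Set A) =
      productRepHom W ⁻¹' {S : lp H 2 →L[ℂ] lp H 2 | IsCompactOperator S} := by
    ext a
    exact mem_compactIdeal W
  rw [hset]
  exact isClosed_setOfPred_isCompactOperator.preimage hcont

variable {W} {J : T → TwoSidedIdeal A}

/-- An element of `J t` acts only on the t-th summand, and compactly there; elements acting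
compactly form a closed ideal. -/
theorem closedIdealSup_le_compactIdeal
    (hJ : ∀ t, IsElementaryIdeal (J t)) (hJinj : Function.Injective J)
    (hirr : ∀ t, IsIrreducibleRep (W t)) (hlift : ∀ t, LiftsIdeal (W t) (J t)) :
    closedIdealSup J ≤ compactIdeal W := by
  classical
  refine sInf_le ⟨isClosed_compactIdeal W, fun t a ha => (mem_compactIdeal W).2 ?_⟩
  have h := (((hirr t).isCompactOperator_of_mem (hJ t) (hlift t) ha).comp_clm
    (lp.evalCLM ℂ H 2 t)).clm_comp (lp.singleContinuousLinearMap ℂ H 2 t)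
  refine (congrArg IsCompactOperator (funext fun x => lp.ext (funext fun s => ?_))).mpr h
  change W s a (x s) = Pi.single (M := H) t (W t a (x t)) s
  by_cases hs : s = t
  · subst hs
    simp
  · rw [Pi.single_eq_of_ne hs,
      (hirr s).map_eq_zero_of_ne (hJ s) (hJ t) (hlift s) (hJinj.ne (Ne.symm hs)) ha]
    rfl

theorem mem_closedIdealSup {t : T} {a : A} (ha : a ∈ J t) : a ∈ closedIdealSup J :=
  (TwoSidedIdeal.mem_sInf A).2 fun _ hI => hI.2 t ha

/-- A family of compact operators, only finitely many of which are nonzero, can be lifted to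
the closed ideal generated by the elementary ideals. -/
theorem exists_mem_closedIdealSup_map_eq
    (hJ : ∀ t, IsElementaryIdeal (J t)) (hJinj : Function.Injective J)
    (hirr : ∀ t, IsIrreducibleRep (W t)) (hlift : ∀ t, LiftsIdeal (W t) (J t))
    {S : ∀ t, H t →L[ℂ] H t}
    (hS : ∀ t, IsCompactOperator (S t)) (hfin : {t | S t ≠ 0}.Finite) :
    ∃ p ∈ closedIdealSup J, ∀ t, W t p = S t := by
  classical
  choose p hpJ hpS using fun t => (hirr t).exists_mem_map_eq (hJ t) (hlift t) (hS t)
  refine ⟨∑ t ∈ hfin.toFinset, p t, ?_, fun s => ?_⟩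
  · exact TwoSidedIdeal.finsetSum_mem _ _ _ fun t _ =>
      mem_closedIdealSup (hpJ t)
  · rw [map_sum, Finset.sum_eq_single s, hpS]
    · intro t _ hts
      exact (hirr s).map_eq_zero_of_ne (hJ s) (hJ t) (hlift s) (hJinj.ne hts) (hpJ t)
    · intro hs
      rw [hpS]
      simpa using hs

/-- Kernel vectors from different summands are orthogonal, hence independent, in the kernel of the
product. -/
theorem finite_setOf_ker_ne_bot {a : A} (ha : FiniteDimensional ℂ (productRep W a).ker) :
    {t | (W t a).ker ≠ ⊥}.Finite := by
  classical
  have hex : ∀ t : {t | (W t a).ker ≠ ⊥}, ∃ x, W t.1 a x = 0 ∧ x ≠ 0 := fun t => by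
    obtain ⟨x, hx, hx0⟩ := Submodule.exists_mem_ne_zero_of_ne_bot t.2
    exact ⟨x, hx, hx0⟩
  choose x hx hx0 using hex
  let y : {t | (W t a).ker ≠ ⊥} → (productRep W a).ker := fun t =>
    ⟨lp.single 2 t.1 (x t), by
      change productRep W a _ = 0
      rw [productRep_single, hx, lp.single_zero]⟩
  have hy : LinearIndependent ℂ y := by
    refine linearIndependent_of_ne_zero_of_inner_eq_zero (fun t h => hx0 t ?_) fun s t hst => ?_
    · have h1 : ‖lp.single 2 t.1 (x t)‖ = 0 := by
        rw [norm_eq_zero]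
        exact congrArg Subtype.val h
      rwa [lp.norm_single (by norm_num), norm_eq_zero] at h1
    · change inner ℂ (lp.single 2 s.1 (x s)) (lp.single 2 t.1 (x t)) = 0
      rw [lp.inner_single_left, lp.single_apply_ne, inner_zero_right]
      exact fun h => hst (Subtype.ext h)
  exact Set.finite_coe_iff.1 hy.finite_of_isNoetherian

theorem finiteDimensional_ker {a : A} (ha : FiniteDimensional ℂ (productRep W a).ker) (t : T) :
    FiniteDimensional ℂ (W t a).ker := by
  classical
  let f : (W t a).ker →ₗ[ℂ] (productRep W a).ker :=
    (((lp.singleContinuousLinearMap ℂ H 2 t).toLinearMap.comp (W t a).ker.subtype)).codRestrict _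
      fun x => by
        change productRep W a (lp.single 2 t x.1) = 0
        rw [productRep_single, show W t a x.1 = 0 from x.2, lp.single_zero]
  refine FiniteDimensional.of_injective f fun x y hxy => Subtype.ext ?_
  exact (lp.isometry_single (E := H) (p := 2) t).injective (congrArg Subtype.val hxy)

/-- If `W a` is Fredholm, then `a* a` is invertible modulo the ideal generated by the elementary
ideals. -/
theorem exists_isUnit_star_mul_self_add
    (hJ : ∀ t, IsElementaryIdeal (J t)) (hJinj : Function.Injective J)
    (hirr : ∀ t, IsIrreducibleRep (W t)) (hlift : ∀ t, LiftsIdeal (W t) (J t))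
    (hspec : IsSpectralFamily W) {a : A} (ha : (productRep W a).IsFredholm) :
    ∃ p ∈ closedIdealSup J, IsUnit (star a * a + p) := by
  classical
  have hfd := finiteDimensional_ker ha.finite_ker
  obtain ⟨p, hp, hpW⟩ := exists_mem_closedIdealSup_map_eq hJ hJinj hirr hlift
    (S := fun t => (W t a).ker.starProjection) (fun t => isCompactOperator_starProjection _)
    ((finite_setOf_ker_ne_bot ha.finite_ker).subset fun t ht h => ht (by simp [h]))
  obtain ⟨C, -, hC⟩ := ha.exists_le_norm_apply
  refine ⟨p, hp, (hspec _).2 ⟨C ^ 2 + 1, fun t => ?_⟩⟩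
  rw [map_add, map_mul, map_star, hpW]
  refine exists_unit_norm_inv_le_of_coercive (by positivity)
    (coercive_star_mul_self_add_starProjection_ker fun x hx => ?_)
  -- A vector of one summand orthogonal to the kernel there is orthogonal to the whole kernel of the
  -- product, so one `C` serves every `t`.
  have h := hC (lp.single 2 t x) fun y hy => by
    rw [lp.inner_single_left]
    refine hx _ ?_
    rw [← productRep_apply, hy]
    rfl
  rwa [productRep_single, lp.norm_single (by norm_num), lp.norm_single (by norm_num)] at h

end Product

/-! ### The main equivalence -/

theorem corollary5 {A : Type u} [CStarAlgebra A] {T : Type w}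
    (J : T → TwoSidedIdeal A) (hJ : ∀ t, IsElementaryIdeal (J t)) (hJinj : Function.Injective J)
    {H : T → Type v} [∀ t, NormedAddCommGroup (H t)] [∀ t, InnerProductSpace ℂ (H t)]
    [∀ t, CompleteSpace (H t)]
    (W : ∀ t, A →⋆ₐ[ℂ] (H t →L[ℂ] H t)) (hirr : ∀ t, IsIrreducibleRep (W t))
    (hlift : ∀ t, LiftsIdeal (W t) (J t)) (hspec : IsSpectralFamily W) (a : A) :
    IsUnit (a : (closedIdealSup J).ringCon.Quotient) ↔ (productRep W a).IsFredholm := by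
  let q : A →+* (closedIdealSup J).ringCon.Quotient := (closedIdealSup J).ringCon.mk'
  have hq : ∀ b c : A, q b = q c ↔ b - c ∈ closedIdealSup J := fun b c =>
    (RingCon.eq _).trans (TwoSidedIdeal.rel_iff _ b c)
  have hqsurj : Function.Surjective q := fun x => Quotient.inductionOn' x fun b => ⟨b, rfl⟩
  change IsUnit (q a) ↔ _
  constructor
  · intro h
    obtain ⟨x, hx₁, hx₂⟩ := isUnit_iff_exists.1 h
    obtain ⟨b, rfl⟩ := hqsurj x
    rw [← map_mul, ← map_one q, hq] at hx₁ hx₂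
    have h₁ := closedIdealSup_le_compactIdeal hJ hJinj hirr hlift hx₁
    have h₂ := closedIdealSup_le_compactIdeal hJ hJinj hirr hlift hx₂
    rw [mem_compactIdeal, ← productRepHom_apply, map_sub, map_mul, map_one] at h₁ h₂
    exact .of_isCompactOperator_mul_sub_one h₁ h₂
  · intro h
    have key : ∀ b : A, (productRep W b).IsFredholm → IsUnit (q (star b) * q b) := by
      intro b hb
      obtain ⟨p, hp, hu⟩ := exists_isUnit_star_mul_self_add hJ hJinj hirr hlift hspec hb
      rw [← map_mul, (hq (star b * b) (star b * b + p)).2 (by simpa using hp)]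
      exact hu.map q
    have h₁ := key a h
    have h₂ := key (star a) (by
      rw [productRep_star]
      exact h.star)
    rw [star_star] at h₂
    obtain ⟨c, -, hc⟩ := isUnit_iff_exists.1 h₁
    obtain ⟨d, hd, -⟩ := isUnit_iff_exists.1 h₂
    -- Invertibility of a a* gives a right inverse of the coset of `a`, that of a* a a left inverse.
    exact isUnit_iff_exists_and_exists.2
      ⟨⟨_, (mul_assoc _ _ _).symm.trans hd⟩, ⟨_, (mul_assoc _ _ _).trans hc⟩⟩
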